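/- Let $\theta\in\mathbb{R}$ and $c=\frac14-\frac{\theta}{2}$. For each $N$ let $G_N$ be a simple undirected graph on the vertex set $\{1,\dots,N\}$ with adjacency matrix $A^{(N)}$, edge set $E_N$, degrees $d_1^{(N)},\dots,d_N^{(N)}$ and maximum degree $\Delta_N=\max_i d_i^{(N)}$, and let $S=(S_1,\dots,S_N)$ be independent Rademacher random variables, $\mathbb{P}(S_i=1)=\mathbb{P}(S_i=-1)=\frac12$. Put $$\tilde\Phi_N(S)=\tfrac18\,S^{\mathsf T}A^{(N)}S+c\,\mathbb{1}^{\mathsf T}A^{(N)}S,\qquad \sigma_N^2=\frac{|E_N|}{16}+c^2\sum_{i=1}^N\big(d_i^{(N)}\big)^2,\qquad \sigma_N\ge 0 .$$ Then, for every $N$, $\tilde\Phi_N(S)$ is square integrable with $\mathbb{E}[\tilde\Phi_N(S)]=0$ and $\operatorname{Var}(\tilde\Phi_N(S))=\sigma_N^2$. Moreover, if $\sigma_N>0$ for all sufficiently large $N$ (equivalently, $G_N$ has at least one edge for all sufficiently large $N$) and, as $N\to\infty$, (i) $\Delta_N=o(\sigma_N)$, and (ii) $\sum_{i=1}^N\big(d_i^{(N)}\big)^2=O(\sigma_N^2)$,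 then $$\frac{\tilde\Phi_N(S)-\mathbb{E}[\tilde\Phi_N(S)]}{\sigma_N}\;\longrightarrow\;\mathcal N(0,1)\quad\text{in distribution.}$$ -/

import Mathlib

open MeasureTheory ProbabilityTheory Filter Asymptotics
open scoped ENNReal Matrix

/-- The Rademacher law on `ℝ`: mass `1/2` at each of the points `1` and `-1`. -/
noncomputable def rademacher : Measure ℝ :=
  (2⁻¹ : ℝ≥0∞) • Measure.dirac 1 + (2⁻¹ : ℝ≥0∞) • Measure.dirac (-1)

/-- The coefficient `c = 1/4 - θ/2` of the linear term of the potential. -/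
noncomputable def fieldCoeff (θ : ℝ) : ℝ := 1 / 4 - θ / 2

/-- The potential in Ising form, `(1/8) sᵀ A s + (1/4 - θ/2) 𝟙ᵀ A s`. -/
noncomputable def isingPotential {V : Type*} [Fintype V] (A : Matrix V V ℝ) (θ : ℝ)
    (s : V → ℝ) : ℝ :=
  1 / 8 * (s ⬝ᵥ (A *ᵥ s)) + fieldCoeff θ * ((1 : V → ℝ) ⬝ᵥ (A *ᵥ s))

/-- The sum of the squared degrees of a finite simple graph. -/
def sumSqDegrees {V : Type*} [Fintype V] (G : SimpleGraph V) [DecidableRel G.Adj] : ℝ :=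
  ∑ i, (G.degree i : ℝ) ^ 2

/-- `σ² = |E| / 16 + c² ∑ dᵢ²`. -/
noncomputable def sigmaSq {V : Type*} [Fintype V] [DecidableEq V] (G : SimpleGraph V)
    [DecidableRel G.Adj] (θ : ℝ) : ℝ :=
  (G.edgeFinset.card : ℝ) / 16 + fieldCoeff θ ^ 2 * sumSqDegrees G

/-- `σ`, the nonnegative square root of `σ²`. -/
noncomputable def sigma {V : Type*} [Fintype V] [DecidableEq V] (G : SimpleGraph V)
    [DecidableRel G.Adj] (θ : ℝ) : ℝ :=
  Real.sqrt (sigmaSq G θ)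

/-- The random variable `Φ(S)`: the potential of the graph `G` at the random spins `S`. -/
noncomputable def potentialRV {V Ω : Type*} [Fintype V] (G : SimpleGraph V) [DecidableRel G.Adj]
    (θ : ℝ) (S : V → Ω → ℝ) (ω : Ω) : ℝ :=
  isingPotential (G.adjMatrix ℝ) θ (fun i => S i ω)

/-! Tikhomirov's characteristic function form of Stein's method. Write the normalized statistic as
`W = ∑ sᵢ hᵢ`, a quadratic form in random signs with zero diagonal, where `hᵢ` (`halfField`) does
not involve `sᵢ`. Averaging over the flip of each sign gives an exact integration by parts
(`expect_quadForm_mul`). Flipping `sᵢ` changes `W` by `-2 sᵢ ℓᵢ`, with `ℓᵢ` the `localField`, so to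
first order `E[W e^{itW}]` is `it E[Γ e^{itW}]` with `Γ = ∑ hᵢ ℓᵢ`.

The mean of `Γ` is the variance 1, and `Γ - 1` is again a quadratic form in the signs
(`gammaForm_spin`), so its variance is explicit. Hence `φ' + tφ` is small for `φ(t) = E e^{itW}`,
and integration gives `φ(t) ≈ e^{-t²/2}` (`norm_quadCharFun_sub_le`).

For a graph, the Taylor error is of order `Δ ∑ dᵢ² / σ³` and the standard deviation of `Γ` of order
`(Δ² ∑ dᵢ² / σ⁴)^{1/2}`. Both vanish under (i) and (ii), and Lévy's continuity theorem concludes. -/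

section SignCube

open Finset
open scoped BigOperators

variable {V : Type*}

/-- The real vector of a configuration of signs. -/
def spin (ε : V → ℤˣ) (i : V) : ℝ := ((ε i : ℤ) : ℝ)

lemma spin_mul_self (ε : V → ℤˣ) (i : V) : spin ε i * spin ε i = 1 := by
  rcases Int.units_eq_one_or (ε i) with h | h <;> simp [spin, h]

lemma abs_spin (ε : V → ℤˣ) (i : V) : |spin ε i| = 1 := by
  rcases Int.units_eq_one_or (ε i) with h | h <;> simp [spin, h]

section Flip

variable [DecidableEq V]

/-- The configuration with the sign at `i` reversed. -/
def flipSign (i : V) (ε : V → ℤˣ) : V → ℤˣ := Function.update ε i (-ε i)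

lemma flipSign_involutive (i : V) : Function.Involutive (flipSign i) := by
  intro ε
  simp [flipSign]

lemma spin_flipSign_self (i : V) (ε : V → ℤˣ) : spin (flipSign i ε) i = -spin ε i := by
  simp [spin, flipSign]

lemma spin_flipSign_of_ne {i j : V} (h : j ≠ i) (ε : V → ℤˣ) :
    spin (flipSign i ε) j = spin ε j := by
  simp [spin, flipSign, h]

lemma spin_flipSign (i : V) (ε : V → ℤˣ) :
    spin (flipSign i ε) = spin ε - (2 * spin ε i) • Pi.single i (1 : ℝ) := by
  ext j
  rcases eq_or_ne j i with rfl | h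
  · rw [spin_flipSign_self]; simp; ring
  · rw [spin_flipSign_of_ne h]; simp [h]

end Flip

/-! ### Quadratic forms in signs: integration by parts and variance. -/

variable [Fintype V]

/-- `bᵢ + ½ (B s)ᵢ`. -/
noncomputable def halfField (b : V → ℝ) (B : Matrix V V ℝ) (s : V → ℝ) (i : V) : ℝ :=
  b i + 1 / 2 * (B *ᵥ s) i

/-- `bᵢ + (B s)ᵢ`. -/
noncomputable def localField (b : V → ℝ) (B : Matrix V V ℝ) (s : V → ℝ) (i : V) : ℝ :=
  b i + (B *ᵥ s) i

/-- The inhomogeneous quadratic form `b · s + ½ sᵀ B s`. -/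
noncomputable def quadForm (b : V → ℝ) (B : Matrix V V ℝ) (s : V → ℝ) : ℝ :=
  ∑ i, s i * halfField b B s i

/-- The variance `∑ bᵢ² + ½ ∑ Bᵢⱼ²` of the quadratic form at random signs. -/
noncomputable def quadVar (b : V → ℝ) (B : Matrix V V ℝ) : ℝ :=
  ∑ i, b i ^ 2 + 1 / 2 * ∑ i, ∑ j, B i j ^ 2

lemma quadForm_eq (b : V → ℝ) (B : Matrix V V ℝ) (s : V → ℝ) :
    quadForm b B s = s ⬝ᵥ b + 1 / 2 * (s ⬝ᵥ (B *ᵥ s)) := by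
  simp only [quadForm, halfField, dotProduct, mul_add, sum_add_distrib, mul_sum]
  congr 1
  exact sum_congr rfl fun i _ => by ring

variable [DecidableEq V]

lemma expect_comp_flipSign {𝕜 : Type*} [RCLike 𝕜] (i : V) (f : (V → ℤˣ) → 𝕜) :
    𝔼 ε, f (flipSign i ε) = 𝔼 ε, f ε :=
  Fintype.expect_equiv (flipSign_involutive i).toPerm _ _ fun _ => rfl

variable {b : V → ℝ} {B : Matrix V V ℝ}

lemma mulVec_flipSign (B : Matrix V V ℝ) (i j : V) (ε : V → ℤˣ) :
    (B *ᵥ spin (flipSign i ε)) j = (B *ᵥ spin ε) j - 2 * spin ε i * B j i := by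
  rw [spin_flipSign, Matrix.mulVec_sub, Matrix.mulVec_smul, Matrix.mulVec_single_one]
  simp

lemma halfField_flipSign (hB0 : ∀ i, B i i = 0) (i : V) (ε : V → ℤˣ) :
    halfField b B (spin (flipSign i ε)) i = halfField b B (spin ε) i := by
  simp [halfField, mulVec_flipSign, hB0]

/-- With zero diagonal the form is affine in `sᵢ`; symmetry of `B` makes its slope the local field.
-/
lemma quadForm_flipSign (hB : B.IsSymm) (hB0 : ∀ i, B i i = 0) (i : V) (ε : V → ℤˣ) :
    quadForm b B (spin (flipSign i ε)) =
      quadForm b B (spin ε) - 2 * (spin ε i * localField b B (spin ε) i) := by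
  have h1 : spin ε ⬝ᵥ B.col i = (B *ᵥ spin ε) i := by
    rw [dotProduct_comm]
    simp only [dotProduct, Matrix.mulVec, Matrix.col_apply]
    exact sum_congr rfl fun j _ => by rw [hB.apply]
  simp only [quadForm_eq, spin_flipSign, Matrix.mulVec_sub, Matrix.mulVec_smul,
    Matrix.mulVec_single_one, sub_dotProduct, dotProduct_sub, smul_dotProduct, dotProduct_smul,
    single_one_dotProduct, h1, localField, smul_eq_mul, Matrix.col_apply, hB0]
  ring

/-- Integration by parts on the sign cube. -/
lemma expect_quadForm_mul {𝕜 : Type*} [RCLike 𝕜] (hB0 : ∀ i, B i i = 0) (h : (V → ℤˣ) → 𝕜) :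
    𝔼 ε, (quadForm b B (spin ε) : 𝕜) * h ε =
      𝔼 ε, ∑ i, (halfField b B (spin ε) i : 𝕜) * ((spin ε i : 𝕜) * (h ε - h (flipSign i ε)) / 2) := by
  simp only [quadForm, RCLike.ofReal_sum, sum_mul]
  rw [expect_sum_comm, expect_sum_comm]
  refine sum_congr rfl fun i _ => ?_
  -- The half field at `i` ignores `sᵢ`, so the flip only negates `sᵢ` and moves `h`; the right side
  -- averages the two equal expressions.
  have key := expect_comp_flipSign i
    fun ε => (halfField b B (spin ε) i : 𝕜) * (spin ε i : 𝕜) * h ε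
  simp only [halfField_flipSign hB0, spin_flipSign_self, RCLike.ofReal_neg] at key
  have h2 : 𝔼 ε, ((spin ε i * halfField b B (spin ε) i : ℝ) : 𝕜) * h ε =
      𝔼 ε, (halfField b B (spin ε) i : 𝕜) * (spin ε i : 𝕜) * h ε :=
    expect_congr rfl fun ε _ => by push_cast; ring
  have h3 : 𝔼 ε, (halfField b B (spin ε) i : 𝕜) * ((spin ε i : 𝕜) * (h ε - h (flipSign i ε)) / 2) =
      (𝔼 ε, (halfField b B (spin ε) i : 𝕜) * (spin ε i : 𝕜) * h ε +
        𝔼 ε, (halfField b B (spin ε) i : 𝕜) * -(spin ε i : 𝕜) * h (flipSign i ε)) / 2 := by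
    rw [← expect_add_distrib, expect_div]
    exact expect_congr rfl fun ε _ => by ring
  rw [h2, h3, key]
  ring

lemma expect_quadForm (hB0 : ∀ i, B i i = 0) : 𝔼 ε, quadForm b B (spin ε) = 0 := by
  simpa using expect_quadForm_mul (𝕜 := ℝ) (b := b) hB0 fun _ => 1

/-- The carré du champ type functional whose mean is the variance of the quadratic form. -/
noncomputable def gammaForm (b : V → ℝ) (B : Matrix V V ℝ) (s : V → ℝ) : ℝ :=
  ∑ i, halfField b B s i * localField b B s i

/-- The off-diagonal part of `B²`. -/
def offDiagSq (B : Matrix V V ℝ) : Matrix V V ℝ := B * B - Matrix.diagonal fun i => (B * B) i i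

lemma offDiagSq_apply_self (B : Matrix V V ℝ) (i : V) : offDiagSq B i i = 0 := by
  simp [offDiagSq]

lemma offDiagSq_isSymm (hB : B.IsSymm) : (offDiagSq B).IsSymm := by
  unfold offDiagSq
  refine Matrix.IsSymm.sub ?_ (Matrix.isSymm_diagonal _)
  rw [Matrix.IsSymm, Matrix.transpose_mul, hB.eq]

/-- Since `sᵢ² = 1`, the diagonal of `B²` contributes only a constant. What remains has zero
diagonal, so the second moment formula for quadratic forms applies to the fluctuation of `Γ` as
well. -/
lemma gammaForm_spin (hB : B.IsSymm) (ε : V → ℤˣ) :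
    gammaForm b B (spin ε) =
      quadForm ((3 / 2 : ℝ) • (B *ᵥ b)) (offDiagSq B) (spin ε) + quadVar b B := by
  set s := spin ε
  have h1 : s ⬝ᵥ (B *ᵥ b) = b ⬝ᵥ (B *ᵥ s) := by
    rw [Matrix.dotProduct_mulVec, ← Matrix.mulVec_transpose, hB.eq, dotProduct_comm]
  have h2 : s ⬝ᵥ ((B * B) *ᵥ s) = (B *ᵥ s) ⬝ᵥ (B *ᵥ s) := by
    rw [← Matrix.mulVec_mulVec, Matrix.dotProduct_mulVec, ← Matrix.mulVec_transpose, hB.eq]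
  have h3 : s ⬝ᵥ ((Matrix.diagonal fun i => (B * B) i i) *ᵥ s) = ∑ i, ∑ j, B i j ^ 2 := by
    simp only [dotProduct, Matrix.mulVec_diagonal]
    refine sum_congr rfl fun i _ => ?_
    have : s i * ((B * B) i i * s i) = (B * B) i i * (s i * s i) := by ring
    rw [this, spin_mul_self, mul_one, Matrix.mul_apply]
    exact sum_congr rfl fun j _ => by rw [hB.apply i j, sq]
  have h4 : gammaForm b B s =
      ∑ i, b i ^ 2 + 3 / 2 * (b ⬝ᵥ (B *ᵥ s)) + 1 / 2 * ((B *ᵥ s) ⬝ᵥ (B *ᵥ s)) := by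
    simp only [gammaForm, halfField, localField, dotProduct, mul_sum, ← sum_add_distrib]
    exact sum_congr rfl fun i _ => by ring
  rw [h4, quadForm_eq, offDiagSq, Matrix.sub_mulVec, dotProduct_sub, h2, h3, dotProduct_smul, h1,
    quadVar, smul_eq_mul]
  ring

lemma expect_gammaForm (hB : B.IsSymm) : 𝔼 ε, gammaForm b B (spin ε) = quadVar b B := by
  simp only [gammaForm_spin hB, expect_add_distrib, expect_quadForm (offDiagSq_apply_self B),
    Fintype.expect_const, zero_add]

/-- Integration by parts with `h = W`: the flip difference is exactly `2 sᵢ ℓᵢ`, which produces `E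
Γ`. -/
lemma expect_quadForm_sq (hB : B.IsSymm) (hB0 : ∀ i, B i i = 0) :
    𝔼 ε, quadForm b B (spin ε) ^ 2 = quadVar b B := by
  have h := expect_quadForm_mul (𝕜 := ℝ) (b := b) hB0 fun ε => quadForm b B (spin ε)
  simp only [RCLike.ofReal_real_eq_id, id, ← sq] at h
  rw [h, ← expect_gammaForm hB]
  refine expect_congr rfl fun ε _ => sum_congr rfl fun i _ => ?_
  rw [quadForm_flipSign hB hB0]
  linear_combination halfField b B (spin ε) i * localField b B (spin ε) i * spin_mul_self ε i

lemma expect_abs_gammaForm_sub_le (hB : B.IsSymm) :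
    𝔼 ε, |gammaForm b B (spin ε) - quadVar b B| ≤
      Real.sqrt (quadVar ((3 / 2 : ℝ) • (B *ᵥ b)) (offDiagSq B)) := by
  have h := expect_mul_sq_le_sq_mul_sq (univ : Finset (V → ℤˣ))
    (fun ε => |gammaForm b B (spin ε) - quadVar b B|) fun _ => 1
  simp only [mul_one, sq_abs, one_pow, Fintype.expect_const] at h
  refine Real.le_sqrt_of_sq_le (h.trans_eq ?_)
  rw [← expect_quadForm_sq (offDiagSq_isSymm hB) (offDiagSq_apply_self B)]
  exact expect_congr rfl fun ε _ => by rw [gammaForm_spin hB, add_sub_cancel_right]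

/-! ### The characteristic function and its approximate differential equation. -/

lemma norm_cexp_sub_one_sub_le (y : ℝ) :
    ‖Complex.exp (Complex.I * y) - 1 - Complex.I * y‖ ≤ 2 * y ^ 2 := by
  rcases le_total |y| 1 with h | h
  · have := Complex.norm_exp_sub_one_sub_id_le (x := Complex.I * y) (by simpa using h)
    simp only [norm_mul, Complex.norm_I, one_mul, Complex.norm_real, Real.norm_eq_abs, sq_abs] at this
    nlinarith [sq_nonneg y]
  · have h1 := norm_sub_le (Complex.exp (Complex.I * y) - 1) (Complex.I * y)
    have h2 := Real.norm_exp_I_mul_ofReal_sub_one_le (x := y)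
    simp only [norm_mul, Complex.norm_I, one_mul, Complex.norm_real, Real.norm_eq_abs] at h1 h2
    nlinarith [sq_abs y]

/-- The characteristic function of the quadratic form at random signs. -/
noncomputable def quadCharFun (b : V → ℝ) (B : Matrix V V ℝ) (t : ℝ) : ℂ :=
  𝔼 ε : V → ℤˣ, Complex.exp (Complex.I * ((t * quadForm b B (spin ε) : ℝ) : ℂ))

lemma hasDerivAt_quadCharFun (b : V → ℝ) (B : Matrix V V ℝ) (t : ℝ) :
    HasDerivAt (quadCharFun b B) (Complex.I * 𝔼 ε : V → ℤˣ, (quadForm b B (spin ε) : ℂ) *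
      Complex.exp (Complex.I * ((t * quadForm b B (spin ε) : ℝ) : ℂ))) t := by
  unfold quadCharFun
  simp only [Fintype.expect_eq_sum_div_card]
  rw [← mul_div_assoc, mul_sum]
  refine HasDerivAt.div_const (HasDerivAt.fun_sum fun ε _ => ?_) _
  have h := ((((hasDerivAt_id t).mul_const (quadForm b B (spin ε))).ofReal_comp).const_mul
    Complex.I).cexp
  refine h.congr_deriv ?_
  simp only [id, one_mul]
  ring

lemma norm_deriv_quadCharFun_add_le (hB : B.IsSymm) (hB0 : ∀ i, B i i = 0) {R : ℝ}
    (hR : ∀ ε : V → ℤˣ, ∑ i, |halfField b B (spin ε) i| * localField b B (spin ε) i ^ 2 ≤ R)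
    (hv : quadVar b B = 1) (t : ℝ) :
    ‖Complex.I * 𝔼 ε : V → ℤˣ, (quadForm b B (spin ε) : ℂ) *
      Complex.exp (Complex.I * ((t * quadForm b B (spin ε) : ℝ) : ℂ)) + t * quadCharFun b B t‖ ≤
      4 * t ^ 2 * R + |t| * Real.sqrt (quadVar ((3 / 2 : ℝ) • (B *ᵥ b)) (offDiagSq B)) := by
  set δ := Real.sqrt (quadVar ((3 / 2 : ℝ) • (B *ᵥ b)) (offDiagSq B))
  have hδ := expect_abs_gammaForm_sub_le (b := b) hB
  rw [hv] at hδ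
  have ibp := expect_quadForm_mul (𝕜 := ℂ) (b := b) hB0
    fun ε => Complex.exp (Complex.I * ((t * quadForm b B (spin ε) : ℝ) : ℂ))
  simp only [Complex.coe_algebraMap] at ibp
  rw [ibp, quadCharFun, mul_expect, mul_expect, ← expect_add_distrib]
  refine (RCLike.norm_expect_le (K := ℂ)).trans ?_
  have hmain : ∀ ε : V → ℤˣ,
      ‖Complex.I * ∑ i, (halfField b B (spin ε) i : ℂ) * ((spin ε i : ℂ) *
        (Complex.exp (Complex.I * ((t * quadForm b B (spin ε) : ℝ) : ℂ)) -
          Complex.exp (Complex.I * ((t * quadForm b B (spin (flipSign i ε)) : ℝ) : ℂ))) / 2) +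
        t * Complex.exp (Complex.I * ((t * quadForm b B (spin ε) : ℝ) : ℂ))‖ ≤
      4 * t ^ 2 * R + |t| * |gammaForm b B (spin ε) - 1| := by
    intro ε
    set e := Complex.exp (Complex.I * ((t * quadForm b B (spin ε) : ℝ) : ℂ)) with he
    have hen : ‖e‖ = 1 := Complex.norm_exp_I_mul_ofReal _
    set y : V → ℝ := fun i => -2 * t * (spin ε i * localField b B (spin ε) i) with hy
    have hfl : ∀ i, Complex.exp (Complex.I * ((t * quadForm b B (spin (flipSign i ε)) : ℝ) : ℂ)) =
        e * Complex.exp (Complex.I * (y i : ℂ)) := by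
      intro i
      rw [he, ← Complex.exp_add, quadForm_flipSign hB hB0]
      congr 1
      simp only [hy]
      push_cast
      ring
    -- Splitting `e^{iyᵢ} - 1` into `iyᵢ` and a remainder, the linear parts sum to `-tΓe`, which
    -- `te` nearly cancels.
    have hdec : Complex.I * ∑ i, (halfField b B (spin ε) i : ℂ) * ((spin ε i : ℂ) *
        (e - Complex.exp (Complex.I * ((t * quadForm b B (spin (flipSign i ε)) : ℝ) : ℂ))) / 2) +
        t * e =
        e * (∑ i, -Complex.I * (halfField b B (spin ε) i : ℂ) * (spin ε i : ℂ) / 2 *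
          (Complex.exp (Complex.I * (y i : ℂ)) - 1 - Complex.I * (y i : ℂ))
          - t * ((gammaForm b B (spin ε) - 1 : ℝ) : ℂ)) := by
      simp only [gammaForm, Complex.ofReal_sub, Complex.ofReal_sum, Complex.ofReal_mul (halfField b B _ _),
        Complex.ofReal_one]
      rw [mul_sub, mul_sub, mul_sub, mul_one, mul_sum, mul_sum, mul_sum, mul_sum, ← sub_add,
        mul_comm e (t : ℂ), ← sum_sub_distrib]
      congr 1
      refine sum_congr rfl fun i _ => ?_
      have hs : (spin ε i : ℂ) * (spin ε i : ℂ) = 1 := by exact_mod_cast spin_mul_self ε i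
      rw [hfl]
      simp only [hy]
      push_cast
      linear_combination (e * t * (halfField b B (spin ε) i : ℂ) * (localField b B (spin ε) i : ℂ)) *
        ((spin ε i : ℂ) * (spin ε i : ℂ) * Complex.I_sq - hs)
    rw [hdec, norm_mul, hen, one_mul]
    refine (norm_sub_le _ _).trans (add_le_add ?_ ?_)
    -- The factor 4 is `1/2` from the integration by parts, times 2 from the Taylor bound, times 4
    -- from `yᵢ² = 4t²ℓᵢ²`.
    · refine (norm_sum_le _ _).trans ((sum_le_sum (g := fun i => 4 * t ^ 2 *
        (|halfField b B (spin ε) i| * localField b B (spin ε) i ^ 2)) fun i _ => ?_).trans ?_)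
      · simp only [norm_mul, norm_div, norm_neg, Complex.norm_I, Complex.norm_real,
          Real.norm_eq_abs, abs_spin, one_mul, mul_one, RCLike.norm_ofNat]
        have h1 := norm_cexp_sub_one_sub_le (y i)
        have h2 : y i ^ 2 = 4 * t ^ 2 * localField b B (spin ε) i ^ 2 := by
          simp only [hy]
          linear_combination 4 * t ^ 2 * localField b B (spin ε) i ^ 2 * spin_mul_self ε i
        rw [h2] at h1
        refine (mul_le_mul_of_nonneg_left h1 (by positivity)).trans_eq ?_
        ring
      · rw [← mul_sum]
        exact mul_le_mul_of_nonneg_left (hR ε) (by positivity)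
    · simp only [norm_mul, Complex.norm_real, Real.norm_eq_abs, le_refl]
  refine (expect_le_expect fun ε _ => hmain ε).trans ?_
  rw [expect_add_distrib, Fintype.expect_const, ← mul_expect]
  gcongr

/-- The derivative of `e^{x²/2} φ(x)` is `e^{x²/2} (φ' + xφ)`. The mean value inequality on `[-|t|,
|t|]` costs a factor `e^{t²/2}`, which cancels on multiplying back by `e^{-t²/2}`. -/
theorem norm_quadCharFun_sub_le (hB : B.IsSymm) (hB0 : ∀ i, B i i = 0) {R : ℝ}
    (hR : ∀ ε : V → ℤˣ, ∑ i, |halfField b B (spin ε) i| * localField b B (spin ε) i ^ 2 ≤ R)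
    (hv : quadVar b B = 1) (t : ℝ) :
    ‖quadCharFun b B t - Complex.exp (-(t : ℂ) ^ 2 / 2)‖ ≤ (4 * t ^ 2 * R +
      |t| * Real.sqrt (quadVar ((3 / 2 : ℝ) • (B *ᵥ b)) (offDiagSq B))) * |t| := by
  set δ := Real.sqrt (quadVar ((3 / 2 : ℝ) • (B *ᵥ b)) (offDiagSq B)) with hδ
  have hR0 : 0 ≤ R := le_trans (sum_nonneg fun i _ => by positivity) (hR 1)
  set C := 4 * t ^ 2 * R + |t| * δ with hC
  have hder : ∀ x : ℝ, HasDerivAt (fun x : ℝ => Complex.exp ((x : ℂ) ^ 2 / 2) * quadCharFun b B x)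
      (Complex.exp ((x : ℂ) ^ 2 / 2) * (Complex.I * 𝔼 ε : V → ℤˣ, (quadForm b B (spin ε) : ℂ) *
      Complex.exp (Complex.I * ((x * quadForm b B (spin ε) : ℝ) : ℂ)) + x * quadCharFun b B x))
      x := by
    intro x
    have h1 : HasDerivAt (fun x : ℝ => Complex.exp ((x : ℂ) ^ 2 / 2))
        (Complex.exp ((x : ℂ) ^ 2 / 2) * x) x := by
      have h := (((hasDerivAt_pow 2 x).div_const 2).ofReal_comp).cexp
      simpa using h
    exact (h1.mul (hasDerivAt_quadCharFun b B x)).congr_deriv (by ring)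
  have hexp : ∀ x : ℝ, ‖Complex.exp ((x : ℂ) ^ 2 / 2)‖ = Real.exp (x ^ 2 / 2) := by
    intro x
    rw [Complex.norm_exp]
    norm_cast
  have hmv := Convex.norm_image_sub_le_of_norm_hasDerivWithin_le
    (s := Set.Icc (-|t|) |t|) (x := 0) (y := t) (C := Real.exp (t ^ 2 / 2) * C)
    (fun x _ => (hder x).hasDerivWithinAt) (fun x hx => ?_) (convex_Icc _ _)
    (by simp) ⟨neg_abs_le t, le_abs_self t⟩
  · have h0 : quadCharFun b B 0 = 1 := by simp [quadCharFun]
    have hfac : quadCharFun b B t - Complex.exp (-(t : ℂ) ^ 2 / 2) =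
        Complex.exp (-(t : ℂ) ^ 2 / 2) * (Complex.exp ((t : ℂ) ^ 2 / 2) * quadCharFun b B t - 1) := by
      rw [mul_sub, ← mul_assoc, ← Complex.exp_add, neg_div, neg_add_cancel, Complex.exp_zero]
      ring
    have hn : ‖Complex.exp (-(t : ℂ) ^ 2 / 2)‖ = Real.exp (-(t ^ 2 / 2)) := by
      rw [Complex.norm_exp, ← neg_div]
      norm_cast
    simp only [h0, Complex.ofReal_zero, ne_eq, OfNat.ofNat_ne_zero, not_false_eq_true, zero_pow,
      zero_div, Complex.exp_zero, mul_one, sub_zero, Real.norm_eq_abs] at hmv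
    rw [hfac, norm_mul, hn]
    refine (mul_le_mul_of_nonneg_left hmv (Real.exp_pos _).le).trans_eq ?_
    rw [← mul_assoc, ← mul_assoc, ← Real.exp_add]
    simp
  · have hxt : |x| ≤ |t| := abs_le.2 hx
    have hsq : x ^ 2 ≤ t ^ 2 := sq_le_sq.2 hxt
    rw [norm_mul, hexp]
    refine mul_le_mul (Real.exp_le_exp.2 (by linarith))
      ((norm_deriv_quadCharFun_add_le hB hB0 hR hv x).trans ?_) (norm_nonneg _) (Real.exp_pos _).le
    rw [hC]
    gcongr

end SignCube

/-! ### From independent Rademacher variables to averages over the sign cube. -/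

section Law

open Finset
open scoped BigOperators

variable {V Ω : Type*} [Fintype V] [DecidableEq V] [MeasurableSpace Ω] {P : Measure Ω}
  {S : V → Ω → ℝ}

lemma rademacher_eq_sum :
    rademacher = ∑ u : ℤˣ, (2⁻¹ : ℝ≥0∞) • Measure.dirac (((u : ℤ) : ℝ)) := by
  rw [rademacher, show (univ : Finset ℤˣ) = {1, -1} from rfl, sum_pair (by decide)]
  simp

instance : IsProbabilityMeasure rademacher where
  measure_univ := by simp [rademacher, ENNReal.inv_two_add_inv_two]

lemma pi_rademacher_eq_sum : Measure.pi (fun _ : V => rademacher) =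
    ∑ ε : V → ℤˣ, (2⁻¹ : ℝ≥0∞) ^ Fintype.card V • Measure.dirac (spin ε) := by
  refine Measure.pi_eq fun s hs => ?_
  simp only [rademacher_eq_sum, Measure.coe_finsetSum, Finset.sum_apply, Measure.smul_apply,
    smul_eq_mul]
  rw [prod_univ_sum]
  simp only [Fintype.piFinset_univ]
  refine sum_congr rfl fun ε _ => ?_
  rw [prod_mul_distrib, prod_const, card_univ,
    Measure.dirac_apply' _ (MeasurableSet.univ_pi hs)]
  congr 1
  by_cases h : ∀ i, spin ε i ∈ s i
  · rw [Set.indicator_of_mem (Set.mem_univ_pi.2 h), Pi.one_apply, eq_comm]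
    exact prod_eq_one fun i _ => by
      rw [Measure.dirac_apply' _ (hs i)]
      exact Set.indicator_of_mem (h i) _
  · rw [Set.indicator_of_notMem (mt Set.mem_univ_pi.1 h), eq_comm]
    obtain ⟨i, hi⟩ := not_forall.1 h
    exact prod_eq_zero (mem_univ i) (by
      rw [Measure.dirac_apply' _ (hs i)]
      exact Set.indicator_of_notMem hi _)

lemma aemeasurable_signs {V Ω : Type*} [Finite V] [MeasurableSpace Ω] {P : Measure Ω}
    {S : V → Ω → ℝ} (hlaw : ∀ i, HasLaw (S i) rademacher P) :
    AEMeasurable (fun ω i => S i ω) P :=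
  aemeasurable_pi_lambda _ fun i => (hlaw i).aemeasurable

variable {E : Type*} [NormedAddCommGroup E]

/-- The measure is a finite sum of atoms, so `f` needs no measurability or bound. -/
lemma integrable_sum_dirac_spin (f : (V → ℝ) → E) : Integrable f
    (∑ ε : V → ℤˣ, (2⁻¹ : ℝ≥0∞) ^ Fintype.card V • Measure.dirac (spin ε)) := by
  refine integrable_finsetSum_measure.2 fun ε _ => (integrable_dirac (by simp)).smul_measure ?_
  simp

variable [IsProbabilityMeasure P]

lemma map_signs_eq_sum (hind : iIndepFun S P) (hlaw : ∀ i, HasLaw (S i) rademacher P) :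
    P.map (fun ω i => S i ω) =
      ∑ ε : V → ℤˣ, (2⁻¹ : ℝ≥0∞) ^ Fintype.card V • Measure.dirac (spin ε) := by
  rw [(iIndepFun_iff_map_fun_eq_pi_map fun i => (hlaw i).aemeasurable).1 hind,
    ← pi_rademacher_eq_sum]
  simp only [(hlaw _).map_eq]

lemma integrable_comp_signs (hind : iIndepFun S P) (hlaw : ∀ i, HasLaw (S i) rademacher P)
    {f : (V → ℝ) → E} : Integrable (fun ω => f fun i => S i ω) P := by
  refine Integrable.comp_aemeasurable (f := fun ω i => S i ω) (g := f) ?_ (aemeasurable_signs hlaw)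
  rw [map_signs_eq_sum hind hlaw]
  exact integrable_sum_dirac_spin f

lemma integral_comp_signs {𝕜 : Type*} [RCLike 𝕜] (hind : iIndepFun S P)
    (hlaw : ∀ i, HasLaw (S i) rademacher P) (f : (V → ℝ) → 𝕜) :
    ∫ ω, f (fun i => S i ω) ∂P = 𝔼 ε, f (spin ε) := by
  have hm := map_signs_eq_sum hind hlaw
  have hf : AEStronglyMeasurable f (P.map fun ω i => S i ω) := by
    rw [hm]; exact (integrable_sum_dirac_spin f).1
  rw [← integral_map (aemeasurable_signs hlaw) hf, hm, integral_finsetSum_measure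
    (integrable_finsetSum_measure.1 (integrable_sum_dirac_spin f))]
  simp only [integral_smul_measure, integral_dirac, ← smul_sum]
  rw [Fintype.expect_eq_sum_div_card, div_eq_inv_mul, Algebra.smul_def]
  congr 1
  simp [map_ofNat]

end Law

/-! ### Degree estimates for the Ising potential of a graph. -/

section Graph

open Finset
open scoped BigOperators

variable {V : Type*} [Fintype V] (G : SimpleGraph V) [DecidableRel G.Adj]

lemma isingPotential_eq_quadForm (θ : ℝ) (s : V → ℝ) :
    isingPotential (G.adjMatrix ℝ) θ s =
      quadForm (fun i => fieldCoeff θ * G.degree i) ((1 / 4 : ℝ) • G.adjMatrix ℝ) s := by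
  have h : (1 : V → ℝ) ⬝ᵥ (G.adjMatrix ℝ *ᵥ s) = s ⬝ᵥ fun i => (G.degree i : ℝ) := by
    rw [Matrix.dotProduct_mulVec, ← Matrix.mulVec_transpose, G.transpose_adjMatrix, dotProduct_comm]
    congr 1
    ext i
    simp [SimpleGraph.adjMatrix_mulVec_apply]
  have h2 : (fun i => fieldCoeff θ * (G.degree i : ℝ)) =
      fieldCoeff θ • fun i => (G.degree i : ℝ) := rfl
  rw [isingPotential, quadForm_eq, h, h2, dotProduct_smul, Matrix.smul_mulVec, dotProduct_smul,
    smul_eq_mul, smul_eq_mul]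
  ring

lemma quadForm_smul (k : ℝ) (b : V → ℝ) (B : Matrix V V ℝ) (s : V → ℝ) :
    quadForm (k • b) (k • B) s = k * quadForm b B s := by
  simp only [quadForm_eq, dotProduct_smul, Matrix.smul_mulVec, smul_eq_mul]
  ring

lemma quadVar_smul (k : ℝ) (b : V → ℝ) (B : Matrix V V ℝ) :
    quadVar (k • b) (k • B) = k ^ 2 * quadVar b B := by
  simp only [quadVar, Pi.smul_apply, Matrix.smul_apply, smul_eq_mul, mul_pow, ← mul_sum]
  ring

lemma sum_adjMatrix_apply (i : V) : ∑ j, G.adjMatrix ℝ i j = G.degree i := by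
  have := G.adjMatrix_mulVec_const_apply (α := ℝ) (a := 1) (v := i)
  simpa [Matrix.mulVec, dotProduct] using this

lemma sum_degree_eq [DecidableEq V] : ∑ i, (G.degree i : ℝ) = 2 * G.edgeFinset.card := by
  exact_mod_cast G.sum_degrees_eq_twice_card_edges

/-- Entries of `A` are 0 or 1, so `∑ Aᵢⱼ² = 2|E|`, and `1/2 · 1/16 · 2|E| = |E|/16`. -/
lemma quadVar_adjMatrix [DecidableEq V] (θ : ℝ) :
    quadVar (fun i => fieldCoeff θ * G.degree i) ((1 / 4 : ℝ) • G.adjMatrix ℝ) = sigmaSq G θ := by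
  have h : ∀ i j, ((1 / 4 : ℝ) • G.adjMatrix ℝ) i j ^ 2 = 1 / 16 * G.adjMatrix ℝ i j := by
    intro i j
    simp only [Matrix.smul_apply, SimpleGraph.adjMatrix_apply]
    split_ifs <;> norm_num
  simp only [quadVar, h, ← mul_sum, sum_adjMatrix_apply, sum_degree_eq, mul_pow, sigmaSq,
    sumSqDegrees]
  ring

lemma adjMatrix_nonneg {V : Type*} (G : SimpleGraph V) [DecidableRel G.Adj] (i j : V) : 0 ≤ G.adjMatrix ℝ i j := by
  rw [SimpleGraph.adjMatrix_apply]; split_ifs <;> norm_num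

lemma abs_adjMatrix_mulVec_le {x : V → ℝ} {M : ℝ} (hx : ∀ i, |x i| ≤ M) (i : V) :
    |(G.adjMatrix ℝ *ᵥ x) i| ≤ M * G.degree i := by
  rw [SimpleGraph.adjMatrix_mulVec_apply]
  refine (abs_sum_le_sum_abs _ _).trans ((sum_le_card_nsmul _ _ M fun j _ => hx j).trans_eq ?_)
  rw [G.card_neighborFinset_eq_degree, nsmul_eq_mul, mul_comm]

lemma degree_le_maxDegree_real (i : V) : (G.degree i : ℝ) ≤ G.maxDegree := by
  exact_mod_cast G.degree_le_maxDegree i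

lemma adjMatrix_mul_self_nonneg (i j : V) : 0 ≤ (G.adjMatrix ℝ * G.adjMatrix ℝ) i j := by
  rw [Matrix.mul_apply]
  exact sum_nonneg fun k _ => mul_nonneg (adjMatrix_nonneg G _ _) (adjMatrix_nonneg G _ _)

lemma adjMatrix_mul_self_le (i j : V) :
    (G.adjMatrix ℝ * G.adjMatrix ℝ) i j ≤ G.maxDegree := by
  refine le_trans ?_ (degree_le_maxDegree_real G i)
  rw [Matrix.mul_apply, ← sum_adjMatrix_apply]
  refine sum_le_sum fun k _ => mul_le_of_le_one_right (adjMatrix_nonneg G _ _) ?_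
  rw [SimpleGraph.adjMatrix_apply]; split_ifs <;> norm_num

lemma sum_adjMatrix_mul_self_le (i : V) :
    ∑ j, (G.adjMatrix ℝ * G.adjMatrix ℝ) i j ≤ G.maxDegree * G.degree i := by
  simp only [Matrix.mul_apply]
  rw [sum_comm]
  simp only [← mul_sum, sum_adjMatrix_apply]
  rw [← sum_adjMatrix_apply G i, mul_sum]
  refine sum_le_sum fun k _ => ?_
  rw [mul_comm]
  exact mul_le_mul_of_nonneg_right (degree_le_maxDegree_real G k) (adjMatrix_nonneg G _ _)

lemma degree_le_degree_sq (i : V) : (G.degree i : ℝ) ≤ (G.degree i : ℝ) ^ 2 := by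
  exact_mod_cast Nat.le_self_pow two_ne_zero _

/-- Both fields at `i` are at most `k(|c| + 1)dᵢ` in absolute value, and `dᵢ³ ≤ Δ dᵢ²`. -/
lemma sum_halfField_mul_localField_sq_le (c : ℝ) {k : ℝ} (hk : 0 ≤ k) (ε : V → ℤˣ) :
    ∑ i, |halfField (k • fun i => c * (G.degree i : ℝ)) (k • (1 / 4 : ℝ) • G.adjMatrix ℝ)
        (spin ε) i| *
      localField (k • fun i => c * (G.degree i : ℝ)) (k • (1 / 4 : ℝ) • G.adjMatrix ℝ)
        (spin ε) i ^ 2 ≤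
      k ^ 3 * (|c| + 1) ^ 3 * (G.maxDegree * sumSqDegrees G) := by
  have key : ∀ i, ∀ r : ℝ, |r| ≤ 1 → |k * (c * G.degree i) +
      r * (G.adjMatrix ℝ *ᵥ spin ε) i * k| ≤ k * (|c| + 1) * G.degree i := by
    intro i r hr
    have h := abs_adjMatrix_mulVec_le G (x := spin ε) (M := 1) (fun j => (abs_spin ε j).le) i
    refine (abs_add_le _ _).trans ?_
    rw [abs_mul, abs_mul, abs_mul, abs_mul, abs_of_nonneg hk, Nat.abs_cast]
    have h2 := mul_le_mul hr h (abs_nonneg _) zero_le_one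
    have h3 := mul_le_mul_of_nonneg_right h2 hk
    linarith
  rw [sumSqDegrees, mul_sum, mul_sum]
  refine sum_le_sum fun i _ => ?_
  have h1 := key i (1 / 8) (by norm_num [abs_of_pos])
  have h2 := key i (1 / 4) (by norm_num [abs_of_pos])
  have e1 : halfField (k • fun i => c * (G.degree i : ℝ)) (k • (1 / 4 : ℝ) • G.adjMatrix ℝ)
      (spin ε) i = k * (c * G.degree i) + 1 / 8 * (G.adjMatrix ℝ *ᵥ spin ε) i * k := by
    simp only [halfField, Matrix.smul_mulVec, Pi.smul_apply, smul_eq_mul]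
    ring
  have e2 : localField (k • fun i => c * (G.degree i : ℝ)) (k • (1 / 4 : ℝ) • G.adjMatrix ℝ)
      (spin ε) i = k * (c * G.degree i) + 1 / 4 * (G.adjMatrix ℝ *ᵥ spin ε) i * k := by
    simp only [localField, Matrix.smul_mulVec, Pi.smul_apply, smul_eq_mul]
    ring
  rw [e1, e2, ← sq_abs (_ + _)]
  calc _ ≤ k * (|c| + 1) * G.degree i * (k * (|c| + 1) * G.degree i) ^ 2 := by gcongr
    _ = k ^ 3 * (|c| + 1) ^ 3 * (G.degree i * (G.degree i : ℝ) ^ 2) := by ring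
    _ ≤ _ := by gcongr; exact G.degree_le_maxDegree i

variable [DecidableEq V]

lemma offDiagSq_smul_adjMatrix_sq_le (k : ℝ) (i j : V) :
    offDiagSq (k • G.adjMatrix ℝ) i j ^ 2 ≤
      k ^ 4 * (G.maxDegree * (G.adjMatrix ℝ * G.adjMatrix ℝ) i j) := by
  have h0 := adjMatrix_mul_self_nonneg G i j
  have h1 := adjMatrix_mul_self_le G i j
  rcases eq_or_ne i j with rfl | hij
  · rw [offDiagSq_apply_self]
    exact (zero_pow two_ne_zero).trans_le (by have := h0.trans h1; positivity)
  · rw [offDiagSq, Matrix.sub_apply, Matrix.diagonal_apply_ne _ hij, sub_zero, Matrix.smul_mul,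
      Matrix.mul_smul, Matrix.smul_apply, Matrix.smul_apply, smul_eq_mul, smul_eq_mul]
    calc (k * (k * (G.adjMatrix ℝ * G.adjMatrix ℝ) i j)) ^ 2
        = k ^ 4 * ((G.adjMatrix ℝ * G.adjMatrix ℝ) i j * (G.adjMatrix ℝ * G.adjMatrix ℝ) i j) := by
          ring
      _ ≤ _ := by gcongr

/-- The linear part uses `(A d)ᵢ ≤ Δ dᵢ`. For the quadratic part, entries of `A²` lie in `[0, Δ]`
and its row sums are at most `Δ dᵢ ≤ Δ dᵢ²`. The numerical factors `9/64` and `1/256` are bounded by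
1. -/
lemma quadVar_gamma_adjMatrix_le (c k : ℝ) :
    quadVar ((3 / 2 : ℝ) • ((k • (1 / 4 : ℝ) • G.adjMatrix ℝ) *ᵥ
        (k • fun i => c * (G.degree i : ℝ)))) (offDiagSq (k • (1 / 4 : ℝ) • G.adjMatrix ℝ)) ≤
      k ^ 4 * (c ^ 2 + 1) * ((G.maxDegree : ℝ) ^ 2 * sumSqDegrees G) := by
  have hb : ∀ i, ((3 / 2 : ℝ) • ((k • (1 / 4 : ℝ) • G.adjMatrix ℝ) *ᵥ
      (k • fun i => c * (G.degree i : ℝ)))) i ^ 2 ≤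
      k ^ 4 * c ^ 2 * ((G.maxDegree : ℝ) ^ 2 * (G.degree i : ℝ) ^ 2) := by
    intro i
    have h := abs_adjMatrix_mulVec_le G (x := fun i => (G.degree i : ℝ)) (M := G.maxDegree)
      (fun j => by rw [Nat.abs_cast]; exact degree_le_maxDegree_real G j) i
    have h2 := sq_le_sq' (abs_le.1 h).1 (abs_le.1 h).2
    have h3 : (fun i => c * (G.degree i : ℝ)) = c • fun i => (G.degree i : ℝ) := rfl
    rw [h3]
    simp only [Matrix.smul_mulVec, Matrix.mulVec_smul, Pi.smul_apply, smul_eq_mul]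
    rw [← mul_pow (G.maxDegree : ℝ)]
    have h4 := mul_le_mul_of_nonneg_left h2 (show 0 ≤ k ^ 4 * c ^ 2 by positivity)
    have h5 : 0 ≤ k ^ 4 * c ^ 2 * ((G.adjMatrix ℝ *ᵥ fun i => (G.degree i : ℝ)) i) ^ 2 := by
      positivity
    nlinarith
  have hB : ∀ i, ∑ j, offDiagSq (k • (1 / 4 : ℝ) • G.adjMatrix ℝ) i j ^ 2 ≤
      k ^ 4 * ((G.maxDegree : ℝ) ^ 2 * (G.degree i : ℝ) ^ 2) := by
    intro i
    rw [smul_smul]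
    calc ∑ j, offDiagSq ((k * (1 / 4)) • G.adjMatrix ℝ) i j ^ 2
        ≤ ∑ j, (k * (1 / 4)) ^ 4 * (G.maxDegree * (G.adjMatrix ℝ * G.adjMatrix ℝ) i j) :=
          sum_le_sum fun j _ => offDiagSq_smul_adjMatrix_sq_le G _ i j
      _ = (k * (1 / 4)) ^ 4 * (G.maxDegree * ∑ j, (G.adjMatrix ℝ * G.adjMatrix ℝ) i j) := by
          rw [← mul_sum, ← mul_sum]
      _ ≤ (k * (1 / 4)) ^ 4 * (G.maxDegree * (G.maxDegree * (G.degree i : ℝ) ^ 2)) := by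
          gcongr
          refine (sum_adjMatrix_mul_self_le G i).trans ?_
          gcongr
          exact degree_le_degree_sq G i
      _ = 1 / 256 * (k ^ 4 * ((G.maxDegree : ℝ) ^ 2 * (G.degree i : ℝ) ^ 2)) := by ring
      _ ≤ _ := mul_le_of_le_one_left (by positivity) (by norm_num)
  have h1 := sum_le_sum fun i (_ : i ∈ univ) => hb i
  have h2 := sum_le_sum fun i (_ : i ∈ univ) => hB i
  simp only [← mul_sum] at h1 h2
  have h3 : 0 ≤ k ^ 4 * ((G.maxDegree : ℝ) ^ 2 * sumSqDegrees G) := by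
    unfold sumSqDegrees
    positivity
  unfold quadVar sumSqDegrees at *
  linarith

lemma isSymm_smul_adjMatrix {V : Type*} (G : SimpleGraph V) [DecidableRel G.Adj] (k : ℝ) : (k • (1 / 4 : ℝ) • G.adjMatrix ℝ).IsSymm :=
  ((G.isSymm_adjMatrix (α := ℝ)).smul _).smul _

lemma norm_quadCharFun_adjMatrix_sub_le (θ t : ℝ) (hσ : 0 < sigma G θ) :
    ‖quadCharFun ((sigma G θ)⁻¹ • fun i => fieldCoeff θ * (G.degree i : ℝ))
      ((sigma G θ)⁻¹ • (1 / 4 : ℝ) • G.adjMatrix ℝ) t - Complex.exp (-(t : ℂ) ^ 2 / 2)‖ ≤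
    (4 * t ^ 2 * ((|fieldCoeff θ| + 1) ^ 3 *
        (G.maxDegree / sigma G θ * (sumSqDegrees G / sigma G θ ^ 2))) +
      |t| * Real.sqrt ((fieldCoeff θ ^ 2 + 1) *
        ((G.maxDegree / sigma G θ) ^ 2 * (sumSqDegrees G / sigma G θ ^ 2)))) * |t| := by
  have hv : quadVar ((sigma G θ)⁻¹ • fun i => fieldCoeff θ * (G.degree i : ℝ))
      ((sigma G θ)⁻¹ • (1 / 4 : ℝ) • G.adjMatrix ℝ) = 1 := by
    rw [quadVar_smul, quadVar_adjMatrix, inv_pow, sigma,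
      Real.sq_sqrt (Real.sqrt_pos.1 hσ).le, inv_mul_cancel₀ (Real.sqrt_pos.1 hσ).ne']
  have h1 : ∀ x : ℝ, (sigma G θ)⁻¹ ^ 3 * x * (G.maxDegree * sumSqDegrees G) =
      x * (G.maxDegree / sigma G θ * (sumSqDegrees G / sigma G θ ^ 2)) := fun x => by
    simp only [div_eq_mul_inv]
    ring
  have h2 : ∀ x : ℝ, (sigma G θ)⁻¹ ^ 4 * x * ((G.maxDegree : ℝ) ^ 2 * sumSqDegrees G) =
      x * ((G.maxDegree / sigma G θ) ^ 2 * (sumSqDegrees G / sigma G θ ^ 2)) := fun x => by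
    simp only [div_eq_mul_inv]
    ring
  rw [← h1, ← h2]
  refine (norm_quadCharFun_sub_le (isSymm_smul_adjMatrix G _) (by simp)
    (sum_halfField_mul_localField_sq_le G (fieldCoeff θ) (inv_pos.2 hσ).le) hv t).trans ?_
  gcongr
  exact quadVar_gamma_adjMatrix_le G _ _

end Graph

/-! ### Moments and the central limit theorem. -/

theorem mainTheorem4
    (θ : ℝ)
    (G : (N : ℕ) → SimpleGraph (Fin N)) [∀ N, DecidableRel (G N).Adj]
    {Ω : ℕ → Type*} [∀ N, MeasurableSpace (Ω N)]
    (P : (N : ℕ) → Measure (Ω N)) [∀ N, IsProbabilityMeasure (P N)]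
    (S : (N : ℕ) → Fin N → Ω N → ℝ)
    (hS_indep : ∀ N, iIndepFun (S N) (P N))
    (hS_law : ∀ N i, HasLaw (S N i) rademacher (P N)) :
    (∀ N, MemLp (potentialRV (G N) θ (S N)) 2 (P N) ∧
      ∫ ω, potentialRV (G N) θ (S N) ω ∂(P N) = 0 ∧
      variance (potentialRV (G N) θ (S N)) (P N) = sigmaSq (G N) θ) ∧
    ((∀ᶠ N in atTop, 0 < sigma (G N) θ) →
      (fun N => ((G N).maxDegree : ℝ)) =o[atTop] (fun N => sigma (G N) θ) →
      (fun N => sumSqDegrees (G N)) =O[atTop] (fun N => sigma (G N) θ ^ 2) →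
      TendstoInDistribution
        (fun N ω => (potentialRV (G N) θ (S N) ω - ∫ ω', potentialRV (G N) θ (S N) ω' ∂(P N))
          / sigma (G N) θ)
        atTop (id : ℝ → ℝ) P (gaussianReal 0 1)) := by
  have hpot : ∀ N, potentialRV (G N) θ (S N) = fun ω =>
      quadForm (fun i => fieldCoeff θ * (G N).degree i) ((1 / 4 : ℝ) • (G N).adjMatrix ℝ)
        (fun i => S N i ω) := fun N => funext fun ω => isingPotential_eq_quadForm (G N) θ _
  have hB0 : ∀ N i, ((1 / 4 : ℝ) • (G N).adjMatrix ℝ) i i = 0 := by simp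
  have hB : ∀ N, ((1 / 4 : ℝ) • (G N).adjMatrix ℝ).IsSymm := fun N =>
    ((G N).isSymm_adjMatrix (α := ℝ)).smul _
  have hint : ∀ N, Integrable (potentialRV (G N) θ (S N)) (P N) := fun N => by
    rw [hpot]; exact integrable_comp_signs (hS_indep N) (hS_law N)
  have hmean : ∀ N, ∫ ω, potentialRV (G N) θ (S N) ω ∂(P N) = 0 := fun N => by
    rw [hpot, integral_comp_signs (hS_indep N) (hS_law N), expect_quadForm (hB0 N)]
  refine ⟨fun N => ⟨?_, hmean N, ?_⟩, fun hpos hΔ hsum => ?_⟩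
  · rw [memLp_two_iff_integrable_sq (hint N).1, hpot]
    exact integrable_comp_signs (hS_indep N) (hS_law N) (f := fun s => quadForm _ _ s ^ 2)
  · rw [variance_of_integral_eq_zero (hint N).aemeasurable (hmean N), hpot]
    rw [integral_comp_signs (hS_indep N) (hS_law N) (f := fun s => quadForm _ _ s ^ 2),
      expect_quadForm_sq (hB N) (hB0 N), quadVar_adjMatrix]
  · have hmeas : ∀ N, AEMeasurable (fun ω => (potentialRV (G N) θ (S N) ω -
        ∫ ω', potentialRV (G N) θ (S N) ω' ∂(P N)) / sigma (G N) θ) (P N) := fun N =>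
      ((hint N).aemeasurable.sub_const _).div_const _
    refine ⟨hmeas, aemeasurable_id, ProbabilityMeasure.tendsto_iff_tendsto_charFun.2 fun t => ?_⟩
    -- This holds even when `σ = 0`: division by zero and `0⁻¹ = 0` make both sides 1.
    have hchar : ∀ N, charFun ((P N).map fun ω => (potentialRV (G N) θ (S N) ω -
        ∫ ω', potentialRV (G N) θ (S N) ω' ∂(P N)) / sigma (G N) θ) t =
        quadCharFun ((sigma (G N) θ)⁻¹ • fun i => fieldCoeff θ * ((G N).degree i : ℝ))
          ((sigma (G N) θ)⁻¹ • (1 / 4 : ℝ) • (G N).adjMatrix ℝ) t := by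
      intro N
      rw [charFun_apply_real, integral_map (hmeas N) (by fun_prop), hmean, hpot, quadCharFun,
        ← integral_comp_signs (hS_indep N) (hS_law N) (f := fun s => Complex.exp (Complex.I *
          ((t * quadForm ((sigma (G N) θ)⁻¹ • fun i => fieldCoeff θ * ((G N).degree i : ℝ))
          ((sigma (G N) θ)⁻¹ • (1 / 4 : ℝ) • (G N).adjMatrix ℝ) s : ℝ) : ℂ)))]
      refine integral_congr_ae (Eventually.of_forall fun ω => ?_)
      simp only [quadForm_smul, sub_zero]
      congr 1
      push_cast
      ring
    simp only [ProbabilityMeasure.coe_mk, hchar, Measure.map_id, charFun_gaussianReal]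
    have hratio := hΔ.tendsto_div_nhds_zero
    have hbdd : (fun N => sumSqDegrees (G N) / sigma (G N) θ ^ 2) =O[atTop]
        (fun _ => (1 : ℝ)) := by
      refine (hsum.mul (isBigO_refl (fun N => (sigma (G N) θ ^ 2)⁻¹) atTop)).trans ?_
      refine IsBigO.of_bound 1 (hpos.mono fun N hN => ?_)
      rw [mul_inv_cancel₀ (pow_pos hN 2).ne']
      simp
    -- Each error term is a null sequence, a power of `Δ/σ`, times the bounded ratio `∑ dᵢ² / σ²`.
    have hprod : ∀ u : ℕ → ℝ, Tendsto u atTop (nhds 0) → Tendsto (fun N => u N *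
        (sumSqDegrees (G N) / sigma (G N) θ ^ 2)) atTop (nhds 0) := fun u hu => by
      have := ((isLittleO_one_iff ℝ).2 hu).mul_isBigO hbdd
      simpa using this.tendsto_div_nhds_zero
    have h1 := hprod _ hratio
    have h2 := hprod _ (by simpa using hratio.pow 2)
    have hlim := (((h1.const_mul ((|fieldCoeff θ| + 1) ^ 3)).const_mul (4 * t ^ 2)).add
      (((h2.const_mul (fieldCoeff θ ^ 2 + 1)).sqrt).const_mul |t|)).mul_const |t|
    simp only [mul_zero, Real.sqrt_zero, add_zero, zero_mul] at hlim
    have hexp : Complex.exp (t * ((0 : ℝ) : ℂ) * Complex.I - ((1 : NNReal) : ℝ) * t ^ 2 / 2) =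
        Complex.exp (-(t : ℂ) ^ 2 / 2) := by
      congr 1
      simp [neg_div]
    refine tendsto_iff_norm_sub_tendsto_zero.2 (squeeze_zero' (Eventually.of_forall fun _ =>
      norm_nonneg _) (hpos.mono fun N hN => ?_) hlim)
    rw [hexp]
    exact norm_quadCharFun_adjMatrix_sub_le (G N) θ t hN
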